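/- Conventions. Let $G$ be a finite group. A right action of $G$ on a category $\mathcal D$ consists of auto-equivalences $\rho_g$ ($g\in G$; write $X^g=\rho_g(X)$) and natural isomorphisms $\theta_{g,h}\colon\rho_g\rho_h\to\rho_{hg}$ with $\theta_{g,kh}\circ\rho_g\theta_{h,k}=\theta_{hg,k}\circ\theta_{g,h}\rho_k$. The category $\mathcal D^G$ has as objects the pairs $(X,(\chi_g)_g)$ with isomorphisms $\chi_g\colon X\to X^g$ such that $\theta_{g,h}\circ(\chi_h)^g\circ\chi_g=\chi_{hg}$, and as morphisms the morphisms of $\mathcal D$ commuting with the $\chi_g$. A $G$-functor is a functor $F$ with natural isomorphisms $\sigma_g\colon F\rho_g\to\hat\rho_gF$ such that $\sigma_{hg}\circ F\theta_{g,h}=\hat\theta_{g,h}F\circ\hat\rho_g\sigma_h\circ\sigma_g\rho_h$; it induces $F^G(X,\chi)=(FX,(\sigma_g\circ F\chi_g)_g)$. An action on a triangulated category is admissible if each $\rho_g$ is a triangulated functor and the $\theta_{g,h}$ commute with the shift isomorphisms $\rho_g[1]\cong[1]\rho_g$ (so $[1]$ is a $G$-functor and $[1]^G$ is a shift on $\mathcal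 D^G$). A $G$-functor between triangulated categories with admissible actions is triangulated if $F$ is triangulated and the $\sigma_g$ commute with the shift isomorphisms. A canonical triangulated structure on $\mathcal T^G$ is a triangulated structure with shift $[1]^G$ for which the forgetful functor $\mathcal T^G\to\mathcal T$ is triangulated; $\mathcal T^G$ is canonically triangulated if it has one. $|G|$ is invertible in $\mathcal T$ if every morphism $f$ is of the form $|G|\cdot f'$. A recollement $\mathsf R_{\mathsf{tr}}(\mathcal U,\mathcal T,\mathcal V)$ of triangulated categories consists of triangulated functors forming adjoint triples $(\mathsf q,\mathsf i,\mathsf p)$, with $\mathsf i\colon\mathcal U\to\mathcal T$, and $(\mathsf l,\mathsf e,\mathsf r)$, with $\mathsf e\colon\mathcal T\to\mathcal V$, the adjunctions being compatible with the shifts, such that $\mathsf i,\mathsf l,\mathsf r$ are fully faithful and the essential image of $\mathsf i$ is $\operatorname{Ker}\mathsf e$ (so that $\mathcal V\simeq\mathcal T/\mathcal U$); $\mathcal U$ is identified with this essential image. Theorem. Let $\mathsf R_{\mathsf{tr}}(\mathcal U,\mathcal T,\mathcal V)$ be a recollement of triangulated categories and let the finite group $G$ act admissibly on $\mathcal T$,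 with $|G|$ invertible in $\mathcal T$ and $\mathcal T^G$ canonically triangulated. The following are equivalent: (i) there are an admissible $G$-action on $\mathcal V$ and a structure of triangulated $G$-functor on $\mathsf e$; (i') there are an admissible $G$-action on $\mathcal V$ and a structure of $G$-functor on $\mathsf e$ (not necessarily compatible with the shifts); (ii) $\mathcal U$ is a $G$-invariant triangulated subcategory of $\mathcal T$, i.e. the essential image of $\mathsf i$ is a triangulated subcategory and $X^g$ lies in it for all $g\in G$ and all $X$ in it. If these hold, there is also an admissible $G$-action on $\mathcal U$ for which $\mathsf i$ is a triangulated $G$-functor. Moreover, for all admissible actions on $\mathcal U$ and $\mathcal V$ and all structures of triangulated $G$-functor on $\mathsf i$ and $\mathsf e$, the functors $\mathsf q,\mathsf p,\mathsf l,\mathsf r$ carry structures of triangulated $G$-functors for which the units and counits of the four adjunctions commute with the actions, $\mathcal U^G$ and $\mathcal V^G$ have canonical triangulated structures, and the functors $\mathsf i^G,\mathsf q^G,\mathsf p^G,\mathsf e^G,\mathsf l^G,\mathsf r^G$ form, with the induced adjunctions, a recollement of triangulated categories $\mathsf R_{\mathsf{tr}}(\mathcal U^G,\mathcal T^G,\mathcal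 V^G)$. -/

import Mathlib

open CategoryTheory CategoryTheory.Limits

universe w v₁ v₂ v₃ u₁ u₂ u₃

namespace EquivariantRecollement

noncomputable section

/-! ### Group actions on categories, equivariant objects, `G`-functors -/

/-- A right action `(ρ, θ)` of a group `G` on a category `C`: auto-equivalences `ρ g` and
composition isomorphisms `θ g h : ρ_g ∘ ρ_h ≅ ρ_{hg}` satisfying the 2-cocycle condition
`θ_{g,kh} ∘ ρ_g θ_{h,k} = θ_{hg,k} ∘ θ_{g,h} ρ_k` (the `eqToHom` is the identification
`ρ_{k(hg)} = ρ_{(kh)g}` given by associativity in `G`).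
Note that `F ⋙ H` is `F` followed by `H`. -/
structure RightAction (G : Type w) [Group G] (C : Type u₁) [Category.{v₁} C] where
  ρ : G → C ⥤ C
  isEquivalence : ∀ g, (ρ g).IsEquivalence
  θ : ∀ g h, ρ h ⋙ ρ g ≅ ρ (h * g)
  cocycle : ∀ (g h k : G) (X : C),
    (ρ g).map ((θ h k).hom.app X) ≫ (θ g (k * h)).hom.app X =
      (θ g h).hom.app ((ρ k).obj X) ≫ (θ (h * g) k).hom.app X ≫
        eqToHom (by rw [mul_assoc])

section Basic

variable {G : Type w} [Group G]
  {C : Type u₁} [Category.{v₁} C] {D : Type u₂} [Category.{v₂} D] {E : Type u₃} [Category.{v₃} E]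

/-- `G`-equivariant objects `(X, χ)` of `C`. -/
structure EquivariantObject (A : RightAction G C) where
  obj : C
  χ : ∀ g, obj ≅ (A.ρ g).obj obj
  cocycle : ∀ g h,
    (χ g).hom ≫ (A.ρ g).map (χ h).hom ≫ (A.θ g h).hom.app obj = (χ (h * g)).hom

namespace EquivariantObject

variable {A : RightAction G C}

/-- Morphisms of equivariant objects: the morphisms which commute with the linearizations. -/
@[ext]
structure Hom (X Y : EquivariantObject A) where
  hom : X.obj ⟶ Y.obj
  comm : ∀ g, (X.χ g).hom ≫ (A.ρ g).map hom = hom ≫ (Y.χ g).hom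

/-- The equivariant category `C^G`. -/
instance : Category.{v₁} (EquivariantObject A) where
  Hom X Y := Hom X Y
  id X := { hom := 𝟙 X.obj, comm := by simp }
  comp f g := { hom := f.hom ≫ g.hom
                comm := fun a => by
                  rw [Functor.map_comp, ← Category.assoc, f.comm, Category.assoc, g.comm,
                    Category.assoc] }

@[simp] lemma id_hom (X : EquivariantObject A) : Hom.hom (𝟙 X) = 𝟙 X.obj := rfl

@[simp] lemma comp_hom {X Y Z : EquivariantObject A} (f : X ⟶ Y) (g : Y ⟶ Z) :
    Hom.hom (f ≫ g) = Hom.hom f ≫ Hom.hom g := rfl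

@[ext] lemma hom_ext {X Y : EquivariantObject A} {f g : X ⟶ Y} (h : Hom.hom f = Hom.hom g) :
    f = g := Hom.ext h

lemma eqToHom_hom {X Y : EquivariantObject A} (h : X = Y) :
    Hom.hom (eqToHom h) = eqToHom (congrArg EquivariantObject.obj h) := by
  subst h
  rfl

/-- The forgetful functor `C^G ⥤ C`. -/
@[simps]
def forget (A : RightAction G C) : EquivariantObject A ⥤ C where
  obj X := X.obj
  map f := Hom.hom f

instance : (forget A).Faithful where
  map_injective h := hom_ext h

/-- An isomorphism of underlying objects commuting with the linearizations. -/
@[simps]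
def isoMk {X Y : EquivariantObject A} (e : X.obj ≅ Y.obj)
    (h : ∀ g, (X.χ g).hom ≫ (A.ρ g).map e.hom = e.hom ≫ (Y.χ g).hom) : X ≅ Y where
  hom := { hom := e.hom, comm := h }
  inv := { hom := e.inv
           comm := fun g => by
            rw [← cancel_epi e.hom, ← reassoc_of% (h g), ← Functor.map_comp]
            simp }
  hom_inv_id := by ext; simp
  inv_hom_id := by ext; simp

end EquivariantObject

/-- A `G`-functor structure `σ` on a functor `F : C ⥤ D` between categories with `G`-actions:
natural isomorphisms `σ_g : F ∘ ρ_g ≅ ρ̂_g ∘ F` compatible with the composition isomorphisms. -/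
structure GFunctor (A : RightAction G C) (B : RightAction G D) (F : C ⥤ D) where
  σ : ∀ g, A.ρ g ⋙ F ≅ F ⋙ B.ρ g
  assoc : ∀ (g h : G) (X : C),
    F.map ((A.θ g h).hom.app X) ≫ (σ (h * g)).hom.app X =
      (σ g).hom.app ((A.ρ h).obj X) ≫ (B.ρ g).map ((σ h).hom.app X) ≫
        (B.θ g h).hom.app (F.obj X)

/-- The identity `G`-functor. -/
@[simps]
def GFunctor.id (A : RightAction G C) : GFunctor A A (𝟭 C) where
  σ g := Functor.rightUnitor _ ≪≫ (Functor.leftUnitor _).symm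
  assoc g h X := by simp

/-- The composition of `G`-functors. -/
@[simps]
def GFunctor.comp {A : RightAction G C} {B : RightAction G D} {K : RightAction G E}
    {F : C ⥤ D} {H : D ⥤ E} (s : GFunctor A B F) (t : GFunctor B K H) :
    GFunctor A K (F ⋙ H) where
  σ g := (Functor.associator _ _ _).symm ≪≫ Functor.isoWhiskerRight (s.σ g) H ≪≫
    Functor.associator _ _ _ ≪≫ Functor.isoWhiskerLeft F (t.σ g) ≪≫
    (Functor.associator _ _ _).symm
  assoc g h X := by
    have h₁ := t.assoc g h (F.obj X)
    have h₂ := congrArg H.map (s.assoc g h X)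
    have h₃ := (t.σ g).hom.naturality ((s.σ h).hom.app X)
    simp only [Functor.map_comp, Functor.comp_obj, Functor.comp_map] at h₁ h₂ h₃
    simp only [Functor.comp_obj, Functor.comp_map, Iso.trans_hom, Iso.symm_hom,
      NatTrans.comp_app, Functor.associator_inv_app, Functor.associator_hom_app,
      Functor.isoWhiskerRight_hom, Functor.isoWhiskerLeft_hom, Functor.whiskerRight_app,
      Functor.whiskerLeft_app, Category.id_comp, Category.comp_id, Functor.map_comp,
      Category.assoc]
    rw [reassoc_of% h₂, h₁, reassoc_of% h₃]

/-- `G`-natural transformations between `G`-functors. -/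
def IsGNatural {A : RightAction G C} {B : RightAction G D} {F H : C ⥤ D}
    (s : GFunctor A B F) (t : GFunctor A B H) (η : F ⟶ H) : Prop :=
  ∀ (g : G) (X : C), η.app ((A.ρ g).obj X) ≫ (t.σ g).hom.app X =
    (s.σ g).hom.app X ≫ (B.ρ g).map (η.app X)

/-- The equivariant functor `F^G : C^G ⥤ D^G`, `(X, χ) ↦ (F X, σ ∘ F χ)`, `f ↦ F f`, induced
by a `G`-functor `(F, σ)`. -/
@[simps]
def GFunctor.equivariant {A : RightAction G C} {B : RightAction G D} {F : C ⥤ D}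
    (s : GFunctor A B F) : EquivariantObject A ⥤ EquivariantObject B where
  obj X :=
    { obj := F.obj X.obj
      χ := fun g => F.mapIso (X.χ g) ≪≫ (s.σ g).app X.obj
      cocycle := fun g h => by
        have h₁ := s.assoc g h X.obj
        have h₂ := (s.σ g).hom.naturality (X.χ h).hom
        have h₃ := congrArg F.map (X.cocycle g h)
        simp only [Functor.map_comp, Functor.comp_obj, Functor.comp_map] at h₁ h₂ h₃
        simp only [Iso.trans_hom, Functor.mapIso_hom, Iso.app_hom, Functor.map_comp,
          Category.assoc]
        rw [← reassoc_of% h₂, ← h₁, ← h₃]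
        simp only [Category.assoc] }
  map {X Y} f :=
    { hom := F.map f.hom
      comm := fun g => by
        have h₂ := (s.σ g).hom.naturality f.hom
        have h₃ := congrArg F.map (f.comm g)
        simp only [Functor.map_comp, Functor.comp_obj, Functor.comp_map] at h₂ h₃
        simp only [Iso.trans_hom, Functor.mapIso_hom, Iso.app_hom, Category.assoc]
        rw [← h₂, reassoc_of% h₃] }
  map_id X := by ext; simp
  map_comp f g := by ext; simp

/-- An adjunction between `G`-functors whose unit and counit are `G`-natural induces an adjunction
between the equivariant functors, whose unit and counit have the same underlying morphisms. -/
def equivariantAdjunction {A : RightAction G C} {B : RightAction G D} {F : C ⥤ D} {H : D ⥤ C}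
    (s : GFunctor A B F) (t : GFunctor B A H) (adj : F ⊣ H)
    (hunit : IsGNatural (GFunctor.id A) (s.comp t) adj.unit)
    (hcounit : IsGNatural (t.comp s) (GFunctor.id B) adj.counit) :
    s.equivariant ⊣ t.equivariant where
  unit :=
    { app := fun X =>
        { hom := adj.unit.app X.obj
          comm := fun g => by
            have h₁ : adj.unit.app ((A.ρ g).obj X.obj) ≫ H.map ((s.σ g).hom.app X.obj) ≫
                (t.σ g).hom.app (F.obj X.obj) = (A.ρ g).map (adj.unit.app X.obj) := by
              simpa using hunit g X.obj
            have h₂ : (X.χ g).hom ≫ adj.unit.app ((A.ρ g).obj X.obj) =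
                adj.unit.app X.obj ≫ H.map (F.map (X.χ g).hom) :=
              adj.unit.naturality (X.χ g).hom
            change (X.χ g).hom ≫ (A.ρ g).map (adj.unit.app X.obj) = adj.unit.app X.obj ≫
              H.map (F.map (X.χ g).hom ≫ (s.σ g).hom.app X.obj) ≫ (t.σ g).hom.app (F.obj X.obj)
            rw [← h₁, reassoc_of% h₂, Functor.map_comp, Category.assoc] }
      naturality := fun X Y f => EquivariantObject.hom_ext (adj.unit.naturality f.hom) }
  counit :=
    { app := fun X =>
        { hom := adj.counit.app X.obj
          comm := fun g => by
            have h₁ : adj.counit.app ((B.ρ g).obj X.obj) = F.map ((t.σ g).hom.app X.obj) ≫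
                (s.σ g).hom.app (H.obj X.obj) ≫ (B.ρ g).map (adj.counit.app X.obj) := by
              simpa using hcounit g X.obj
            have h₂ : F.map (H.map (X.χ g).hom) ≫ adj.counit.app ((B.ρ g).obj X.obj) =
                adj.counit.app X.obj ≫ (X.χ g).hom :=
              adj.counit.naturality (X.χ g).hom
            change (F.map (H.map (X.χ g).hom ≫ (t.σ g).hom.app X.obj) ≫
              (s.σ g).hom.app (H.obj X.obj)) ≫ (B.ρ g).map (adj.counit.app X.obj) =
                adj.counit.app X.obj ≫ (X.χ g).hom
            rw [← h₂, h₁, Functor.map_comp, Category.assoc, Category.assoc] }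
      naturality := fun X Y f => EquivariantObject.hom_ext (adj.counit.naturality f.hom) }
  left_triangle_components X :=
    EquivariantObject.hom_ext (adj.left_triangle_components X.obj)
  right_triangle_components X :=
    EquivariantObject.hom_ext (adj.right_triangle_components X.obj)

/-- A full subcategory (given by a property of objects) is `G`-invariant if `C^g` lies in it
for all `C` in it and all `g`. -/
def IsGInvariant (A : RightAction G C) (P : ObjectProperty C) : Prop :=
  ∀ (g : G) (X : C), P X → P ((A.ρ g).obj X)

end Basic

/-- `|G|` is invertible in the preadditive category `C`: every morphism `f` is of the form
`|G| • f'`. -/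
def CardInvertible (G : Type w) (C : Type u₁) [Category.{v₁} C] [Preadditive C] : Prop :=
  ∀ ⦃X Y : C⦄ (f : X ⟶ Y), ∃ f' : X ⟶ Y, f = Nat.card G • f'

/-! ### Admissible actions on triangulated categories -/

section CommShift

variable {C : Type u₁} [Category.{v₁} C] {D : Type u₂} [Category.{v₂} D]
  [HasShift C ℤ] [HasShift D ℤ]

lemma commShift_zero_inv (F : C ⥤ D) [F.CommShift ℤ] (X : C) :
    (F.commShiftIso (0 : ℤ)).inv.app X ≫ F.map ((shiftFunctorZero C ℤ).hom.app X) =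
      (shiftFunctorZero D ℤ).hom.app (F.obj X) := by
  rw [Functor.commShiftIso_zero, Functor.CommShift.isoZero_inv_app, Category.assoc,
    ← Functor.map_comp, Iso.inv_hom_id_app]
  erw [CategoryTheory.Functor.map_id, Category.comp_id]

lemma commShift_add_inv (F : C ⥤ D) [F.CommShift ℤ] (m n : ℤ) (X : C) :
    (F.commShiftIso (m + n)).inv.app X ≫ F.map ((shiftFunctorAdd C m n).hom.app X) =
      (shiftFunctorAdd D m n).hom.app (F.obj X) ≫
        ((F.commShiftIso m).inv.app X)⟦n⟧' ≫ (F.commShiftIso n).inv.app (X⟦m⟧) := by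
  rw [Functor.commShiftIso_add, Functor.CommShift.isoAdd_inv_app]
  simp only [Category.assoc]
  rw [← Functor.map_comp, Iso.inv_hom_id_app]
  erw [CategoryTheory.Functor.map_id, Category.comp_id]

end CommShift

section Triangulated

variable {G : Type w} [Group G]
  {T : Type u₁} [Category.{v₁} T] [HasZeroObject T] [HasShift T ℤ] [Preadditive T]
  [∀ n : ℤ, (shiftFunctor T n).Additive] [Pretriangulated T]
  {V : Type u₂} [Category.{v₂} V] [HasZeroObject V] [HasShift V ℤ] [Preadditive V]
  [∀ n : ℤ, (shiftFunctor V n).Additive] [Pretriangulated V]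

/-- An admissible action on a triangulated category: each `ρ_g` comes with isomorphisms
`ρ_g ∘ [n] ≅ [n] ∘ ρ_g` which make it a triangulated functor, and these isomorphisms are
compatible with the composition isomorphisms `θ`, i.e. they make the shift functors into
`G`-functors. -/
class Admissible (A : RightAction G T) where
  commShift : ∀ g, (A.ρ g).CommShift ℤ
  isTriangulated : ∀ g, (A.ρ g).IsTriangulated
  commShift_θ : ∀ g h, NatTrans.CommShift (A.θ g h).hom ℤ

attribute [reducible] Admissible.commShift

attribute [instance] Admissible.commShift Admissible.isTriangulated Admissible.commShift_θ

/-- A `G`-functor structure on a triangulated functor between triangulated categories with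
admissible actions is triangulated if the isomorphisms `σ_g` are compatible with the shifts. -/
class IsTriangulatedGFunctor {A : RightAction G T} {B : RightAction G V} [Admissible A]
    [Admissible B] {F : T ⥤ V} [F.CommShift ℤ] (s : GFunctor A B F) : Prop where
  commShift_σ : ∀ g, NatTrans.CommShift (s.σ g).hom ℤ

attribute [instance] IsTriangulatedGFunctor.commShift_σ

namespace EquivariantObject

variable {A : RightAction G T} [Admissible A]

section Preadditive

variable (X Y : EquivariantObject A)

instance : Zero (X ⟶ Y) := ⟨{ hom := 0, comm := by simp }⟩

instance : Add (X ⟶ Y) :=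
  ⟨fun f g => { hom := f.hom + g.hom, comm := fun a => by simp [Functor.map_add, f.comm, g.comm] }⟩

instance : Neg (X ⟶ Y) :=
  ⟨fun f => { hom := -f.hom, comm := fun a => by simp [Functor.map_neg, f.comm] }⟩

instance : Sub (X ⟶ Y) :=
  ⟨fun f g => { hom := f.hom - g.hom, comm := fun a => by simp [Functor.map_sub, f.comm, g.comm] }⟩

instance : SMul ℕ (X ⟶ Y) :=
  ⟨fun n f => { hom := n • f.hom, comm := fun a => by simp [f.comm] }⟩

instance : SMul ℤ (X ⟶ Y) :=
  ⟨fun n f => { hom := n • f.hom, comm := fun a => by simp [f.comm] }⟩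

instance : AddCommGroup (X ⟶ Y) :=
  Function.Injective.addCommGroup (fun f : X ⟶ Y => Hom.hom f) (fun _ _ h => hom_ext h)
    rfl (fun _ _ => rfl) (fun _ => rfl) (fun _ _ => rfl) (fun _ _ => rfl) (fun _ _ => rfl)

end Preadditive

/-- `T^G` is preadditive, with the addition of morphisms of `T`. -/
instance : Preadditive (EquivariantObject A) where
  add_comp X Y Z f f' g := by ext; exact Preadditive.add_comp _ _ _ _ _ _
  comp_add X Y Z f g g' := by ext; exact Preadditive.comp_add _ _ _ _ _ _

@[simp] lemma add_hom {X Y : EquivariantObject A} (f g : X ⟶ Y) :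
    Hom.hom (f + g) = Hom.hom f + Hom.hom g := rfl

@[simp] lemma zero_hom {X Y : EquivariantObject A} : Hom.hom (0 : X ⟶ Y) = 0 := rfl

instance : HasZeroObject (EquivariantObject A) := by
  obtain ⟨Z, hZ⟩ := HasZeroObject.zero (C := T)
  let Z' : EquivariantObject A :=
    { obj := Z
      χ := fun g => hZ.iso ((A.ρ g).map_isZero hZ)
      cocycle := fun g h => hZ.eq_of_src _ _ }
  exact ⟨Z', (IsZero.iff_id_eq_zero Z').2 (hom_ext (hZ.eq_of_src _ _))⟩

/-- The object `X⟦n⟧` of `T^G`, with the linearization `X[n] ≅ X^g[n] ≅ X[n]^g`. -/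
@[simps]
def shiftObj (n : ℤ) (X : EquivariantObject A) : EquivariantObject A where
  obj := X.obj⟦n⟧
  χ g := (shiftFunctor T n).mapIso (X.χ g) ≪≫ ((A.ρ g).commShiftIso n).symm.app X.obj
  cocycle g h := by
    have h₁ : (A.θ g h).hom.app (X.obj⟦n⟧) =
        ((A.ρ g).map (((A.ρ h).commShiftIso n).hom.app X.obj) ≫
          ((A.ρ g).commShiftIso n).hom.app ((A.ρ h).obj X.obj)) ≫
        ((A.θ g h).hom.app X.obj)⟦n⟧' ≫ ((A.ρ (h * g)).commShiftIso n).inv.app X.obj := by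
      have := NatTrans.app_shift (A.θ g h).hom n X.obj
      rwa [Functor.commShiftIso_comp_hom_app] at this
    have h₃ : ((A.ρ g).map (X.χ h).hom)⟦n⟧' ≫
        ((A.ρ g).commShiftIso n).inv.app ((A.ρ h).obj X.obj) =
        ((A.ρ g).commShiftIso n).inv.app X.obj ≫ (A.ρ g).map ((X.χ h).hom⟦n⟧') :=
      ((A.ρ g).commShiftIso n).inv.naturality (X.χ h).hom
    have h₄ : (A.ρ g).map (((A.ρ h).commShiftIso n).inv.app X.obj) ≫
        (A.ρ g).map (((A.ρ h).commShiftIso n).hom.app X.obj) = 𝟙 _ := by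
      rw [← Functor.map_comp, Iso.inv_hom_id_app, CategoryTheory.Functor.map_id]
    have h₅ : ((A.ρ g).commShiftIso n).inv.app ((A.ρ h).obj X.obj) ≫
        ((A.ρ g).commShiftIso n).hom.app ((A.ρ h).obj X.obj) = 𝟙 _ :=
      Iso.inv_hom_id_app _ _
    change ((X.χ g).hom⟦n⟧' ≫ ((A.ρ g).commShiftIso n).inv.app X.obj) ≫
      (A.ρ g).map ((X.χ h).hom⟦n⟧' ≫ ((A.ρ h).commShiftIso n).inv.app X.obj) ≫
        (A.θ g h).hom.app (X.obj⟦n⟧) =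
      (X.χ (h * g)).hom⟦n⟧' ≫ ((A.ρ (h * g)).commShiftIso n).inv.app X.obj
    rw [← X.cocycle g h, h₁]
    simp only [Functor.map_comp, Category.assoc]
    rw [reassoc_of% h₄, ← reassoc_of% h₃, reassoc_of% h₅]

/-- The shift `[n]^G` of `T^G`, induced by the `G`-functor `[n]`. -/
@[simps]
def shift (A : RightAction G T) [Admissible A] (n : ℤ) :
    EquivariantObject A ⥤ EquivariantObject A where
  obj X := shiftObj n X
  map {X Y} f :=
    { hom := f.hom⟦n⟧'
      comm := fun g => by
        have h₁ : ((A.ρ g).map f.hom)⟦n⟧' ≫ ((A.ρ g).commShiftIso n).inv.app Y.obj =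
            ((A.ρ g).commShiftIso n).inv.app X.obj ≫ (A.ρ g).map (f.hom⟦n⟧') :=
          ((A.ρ g).commShiftIso n).inv.naturality f.hom
        change ((X.χ g).hom⟦n⟧' ≫ ((A.ρ g).commShiftIso n).inv.app X.obj) ≫
          (A.ρ g).map (f.hom⟦n⟧') =
          f.hom⟦n⟧' ≫ (Y.χ g).hom⟦n⟧' ≫ ((A.ρ g).commShiftIso n).inv.app Y.obj
        rw [← Functor.map_comp_assoc, ← f.comm, Category.assoc, ← h₁,
          Functor.map_comp, Category.assoc] }
  map_id X := hom_ext (CategoryTheory.Functor.map_id _ _)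
  map_comp f g := hom_ext (Functor.map_comp _ _ _)

instance : HasShift (EquivariantObject A) ℤ :=
  hasShiftMk _ _
    { F := shift A
      zero := NatIso.ofComponents
        (fun X => isoMk ((shiftFunctorZero T ℤ).app X.obj) (fun g => by
          change ((X.χ g).hom⟦(0 : ℤ)⟧' ≫ ((A.ρ g).commShiftIso (0 : ℤ)).inv.app X.obj) ≫
            (A.ρ g).map ((shiftFunctorZero T ℤ).hom.app X.obj) =
            (shiftFunctorZero T ℤ).hom.app X.obj ≫ (X.χ g).hom
          rw [Category.assoc, commShift_zero_inv]
          exact (shiftFunctorZero T ℤ).hom.naturality (X.χ g).hom))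
        (fun f => hom_ext ((shiftFunctorZero T ℤ).hom.naturality f.hom))
      add := fun m n => NatIso.ofComponents
        (fun X => isoMk ((shiftFunctorAdd T m n).app X.obj) (fun g => by
          have h₁ : (X.χ g).hom⟦m + n⟧' ≫ (shiftFunctorAdd T m n).hom.app ((A.ρ g).obj X.obj) =
              (shiftFunctorAdd T m n).hom.app X.obj ≫ (X.χ g).hom⟦m⟧'⟦n⟧' :=
            (shiftFunctorAdd T m n).hom.naturality (X.χ g).hom
          change ((X.χ g).hom⟦m + n⟧' ≫ ((A.ρ g).commShiftIso (m + n)).inv.app X.obj) ≫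
            (A.ρ g).map ((shiftFunctorAdd T m n).hom.app X.obj) =
            (shiftFunctorAdd T m n).hom.app X.obj ≫
              ((X.χ g).hom⟦m⟧' ≫ ((A.ρ g).commShiftIso m).inv.app X.obj)⟦n⟧' ≫
              ((A.ρ g).commShiftIso n).inv.app (X.obj⟦m⟧)
          rw [Category.assoc, commShift_add_inv, reassoc_of% h₁, Functor.map_comp,
            Category.assoc]))
        (fun f => hom_ext ((shiftFunctorAdd T m n).hom.naturality f.hom))
      assoc_hom_app := fun m₁ m₂ m₃ X => hom_ext (by
        have h₁ := shiftFunctorAdd_assoc_hom_app m₁ m₂ m₃ X.obj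
        simp only [shiftFunctorAdd', Iso.trans_hom, NatTrans.comp_app, eqToIso.hom, eqToHom_app,
          Category.assoc] at h₁
        simp only [comp_hom, eqToHom_hom]
        exact h₁)
      zero_add_hom_app := fun n X => hom_ext (by
        have h₁ := shiftFunctorAdd_zero_add_hom_app n X.obj
        simp only [comp_hom, eqToHom_hom]
        exact h₁)
      add_zero_hom_app := fun n X => hom_ext (by
        have h₁ := shiftFunctorAdd_add_zero_hom_app n X.obj
        simp only [comp_hom, eqToHom_hom]
        exact h₁) }

instance (n : ℤ) : (shiftFunctor (EquivariantObject A) n).Additive where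
  map_add {_ _ f g} := hom_ext ((shiftFunctor T n).map_add (f := f.hom) (g := g.hom))

/-- The equality `For ∘ [n]^G = [n] ∘ For`. -/
instance : (forget A).CommShift ℤ where
  commShiftIso n := NatIso.ofComponents (fun X => Iso.refl (X.obj⟦n⟧)) (fun f => by
    exact (Category.comp_id _).trans (Category.id_comp _).symm)
  commShiftIso_zero := by
    ext X
    rw [Functor.CommShift.isoZero_hom_app]
    exact ((shiftFunctorZero T ℤ).hom_inv_id_app X.obj).symm
  commShiftIso_add m n := by
    ext X
    rw [Functor.CommShift.isoAdd_hom_app]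
    change 𝟙 _ = (shiftFunctorAdd T m n).hom.app X.obj ≫ 𝟙 _ ≫ (𝟙 (X.obj⟦m⟧))⟦n⟧' ≫
      (shiftFunctorAdd T m n).inv.app X.obj
    rw [CategoryTheory.Functor.map_id]
    erw [Category.id_comp, Category.id_comp]
    exact ((shiftFunctorAdd T m n).hom_inv_id_app X.obj).symm

end EquivariantObject

open EquivariantObject

/-- The equivariant functor `F^G` of a triangulated `G`-functor commutes with the shifts, via the
isomorphisms `F ∘ [n] ≅ [n] ∘ F`. -/
instance GFunctor.equivariantCommShift {A : RightAction G T} {B : RightAction G V} [Admissible A]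
    [Admissible B] {F : T ⥤ V} [F.CommShift ℤ] (s : GFunctor A B F)
    [IsTriangulatedGFunctor s] : s.equivariant.CommShift ℤ where
  commShiftIso n := NatIso.ofComponents
    (fun X => isoMk ((F.commShiftIso n).app X.obj) (fun g => by
      have h₁ : (s.σ g).hom.app (X.obj⟦n⟧) =
          (F.map (((A.ρ g).commShiftIso n).hom.app X.obj) ≫
            (F.commShiftIso n).hom.app ((A.ρ g).obj X.obj)) ≫
          ((s.σ g).hom.app X.obj)⟦n⟧' ≫
            ((B.ρ g).commShiftIso n).inv.app (F.obj X.obj) ≫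
              (B.ρ g).map ((F.commShiftIso n).inv.app X.obj) := by
        have := NatTrans.app_shift (s.σ g).hom n X.obj
        rwa [Functor.commShiftIso_comp_hom_app, Functor.commShiftIso_comp_inv_app] at this
      have h₂ : F.map ((X.χ g).hom⟦n⟧') ≫ (F.commShiftIso n).hom.app ((A.ρ g).obj X.obj) =
          (F.commShiftIso n).hom.app X.obj ≫ (F.map (X.χ g).hom)⟦n⟧' :=
        (F.commShiftIso n).hom.naturality (X.χ g).hom
      have h₃ : F.map (((A.ρ g).commShiftIso n).inv.app X.obj) ≫
          F.map (((A.ρ g).commShiftIso n).hom.app X.obj) = 𝟙 _ := by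
        rw [← Functor.map_comp, Iso.inv_hom_id_app, CategoryTheory.Functor.map_id]
      have h₄ : (B.ρ g).map ((F.commShiftIso n).inv.app X.obj) ≫
          (B.ρ g).map ((F.commShiftIso n).hom.app X.obj) = 𝟙 _ := by
        rw [← Functor.map_comp, Iso.inv_hom_id_app, CategoryTheory.Functor.map_id]
      change (F.map ((X.χ g).hom⟦n⟧' ≫ ((A.ρ g).commShiftIso n).inv.app X.obj) ≫
        (s.σ g).hom.app (X.obj⟦n⟧)) ≫ (B.ρ g).map ((F.commShiftIso n).hom.app X.obj) =
        (F.commShiftIso n).hom.app X.obj ≫ (F.map (X.χ g).hom ≫ (s.σ g).hom.app X.obj)⟦n⟧' ≫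
          ((B.ρ g).commShiftIso n).inv.app (F.obj X.obj)
      rw [h₁]
      simp only [Functor.map_comp, Category.assoc]
      rw [reassoc_of% h₃, reassoc_of% h₂, h₄]
      erw [Category.comp_id]))
    (fun f => hom_ext ((F.commShiftIso n).hom.naturality f.hom))
  commShiftIso_zero := by
    ext X
    rw [Functor.CommShift.isoZero_hom_app]
    have := congr_app (congrArg Iso.hom (F.commShiftIso_zero ℤ)) X.obj
    rw [Functor.CommShift.isoZero_hom_app] at this
    exact this
  commShiftIso_add m n := by
    ext X
    rw [Functor.CommShift.isoAdd_hom_app]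
    have := congr_app (congrArg Iso.hom (F.commShiftIso_add m n)) X.obj
    rw [Functor.CommShift.isoAdd_hom_app] at this
    exact this

/-- A canonical triangulated structure on `T^G`: a triangulated structure (including the octahedral
axiom), with respect to the shift `[1]^G`, for which the forgetful functor is triangulated. -/
structure CanonicalTriangulation (A : RightAction G T) [Admissible A] where
  pretriangulated : Pretriangulated (EquivariantObject A)
  isTriangulated : IsTriangulated (EquivariantObject A)
  forget_isTriangulated : (forget A).IsTriangulated

end Triangulated

/-! ### Recollements of triangulated categories -/

section Recollement

variable (U : Type u₁) [Category.{v₁} U] [HasShift U ℤ]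
  (T : Type u₂) [Category.{v₂} T] [HasShift T ℤ]
  (V : Type u₃) [Category.{v₃} V] [HasShift V ℤ]

/-- The diagram of functors underlying a recollement: adjoint triples `(q, i, p)` between `U` and
`T` and `(l, e, r)` between `T` and `V`, all functors commuting with the shifts. -/
structure RecollementDiagram where
  i : U ⥤ T
  q : T ⥤ U
  p : T ⥤ U
  e : T ⥤ V
  l : V ⥤ T
  r : V ⥤ T
  adj_qi : q ⊣ i
  adj_ip : i ⊣ p
  adj_le : l ⊣ e
  adj_er : e ⊣ r
  commShift_i : i.CommShift ℤ
  commShift_q : q.CommShift ℤ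
  commShift_p : p.CommShift ℤ
  commShift_e : e.CommShift ℤ
  commShift_l : l.CommShift ℤ
  commShift_r : r.CommShift ℤ

attribute [instance] RecollementDiagram.commShift_i RecollementDiagram.commShift_q
  RecollementDiagram.commShift_p RecollementDiagram.commShift_e RecollementDiagram.commShift_l
  RecollementDiagram.commShift_r

variable {U T V}
variable [HasZeroObject U] [Preadditive U] [∀ n : ℤ, (shiftFunctor U n).Additive]
  [HasZeroObject T] [Preadditive T] [∀ n : ℤ, (shiftFunctor T n).Additive]
  [HasZeroObject V] [Preadditive V] [∀ n : ℤ, (shiftFunctor V n).Additive]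

/-- A recollement of triangulated categories: the six functors are triangulated, the adjunctions
are compatible with the shifts, `i`, `l`, `r` are fully faithful and `Im i = Ker e`. -/
structure RecollementDiagram.IsRecollement [Pretriangulated U] [Pretriangulated T]
    [Pretriangulated V] (R : RecollementDiagram U T V) : Prop where
  isTriangulated_i : R.i.IsTriangulated
  isTriangulated_q : R.q.IsTriangulated
  isTriangulated_p : R.p.IsTriangulated
  isTriangulated_e : R.e.IsTriangulated
  isTriangulated_l : R.l.IsTriangulated
  isTriangulated_r : R.r.IsTriangulated
  commShift_qi : R.adj_qi.CommShift ℤ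
  commShift_ip : R.adj_ip.CommShift ℤ
  commShift_le : R.adj_le.CommShift ℤ
  commShift_er : R.adj_er.CommShift ℤ
  full_i : R.i.Full
  faithful_i : R.i.Faithful
  full_l : R.l.Full
  faithful_l : R.l.Faithful
  full_r : R.r.Full
  faithful_r : R.r.Faithful
  essImage_i_iff : ∀ X : T, R.i.essImage X ↔ IsZero (R.e.obj X)

variable [Pretriangulated U] [Pretriangulated T] [Pretriangulated V] {G : Type w} [Group G]

/-- Triangulated `G`-functor structures on the six functors of a recollement, such that the units
and counits of the four adjunctions are `G`-natural. -/
structure RecollementDiagram.GStructure (R : RecollementDiagram U T V)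
    (AU : RightAction G U) (AT : RightAction G T) (AV : RightAction G V)
    [Admissible AU] [Admissible AT] [Admissible AV] where
  i : GFunctor AU AT R.i
  q : GFunctor AT AU R.q
  p : GFunctor AT AU R.p
  e : GFunctor AT AV R.e
  l : GFunctor AV AT R.l
  r : GFunctor AV AT R.r
  isTriangulated_i : IsTriangulatedGFunctor i
  isTriangulated_q : IsTriangulatedGFunctor q
  isTriangulated_p : IsTriangulatedGFunctor p
  isTriangulated_e : IsTriangulatedGFunctor e
  isTriangulated_l : IsTriangulatedGFunctor l
  isTriangulated_r : IsTriangulatedGFunctor r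
  unit_qi : IsGNatural (GFunctor.id AT) (q.comp i) R.adj_qi.unit
  counit_qi : IsGNatural (i.comp q) (GFunctor.id AU) R.adj_qi.counit
  unit_ip : IsGNatural (GFunctor.id AU) (i.comp p) R.adj_ip.unit
  counit_ip : IsGNatural (p.comp i) (GFunctor.id AT) R.adj_ip.counit
  unit_le : IsGNatural (GFunctor.id AV) (l.comp e) R.adj_le.unit
  counit_le : IsGNatural (e.comp l) (GFunctor.id AT) R.adj_le.counit
  unit_er : IsGNatural (GFunctor.id AT) (e.comp r) R.adj_er.unit
  counit_er : IsGNatural (r.comp e) (GFunctor.id AV) R.adj_er.counit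

attribute [instance] RecollementDiagram.GStructure.isTriangulated_i
  RecollementDiagram.GStructure.isTriangulated_q RecollementDiagram.GStructure.isTriangulated_p
  RecollementDiagram.GStructure.isTriangulated_e RecollementDiagram.GStructure.isTriangulated_l
  RecollementDiagram.GStructure.isTriangulated_r

/-- The diagram `(U^G, T^G, V^G)` with the functors `i^G, q^G, p^G, e^G, l^G, r^G`. -/
def RecollementDiagram.equivariant (R : RecollementDiagram U T V)
    {AU : RightAction G U} {AT : RightAction G T} {AV : RightAction G V}
    [Admissible AU] [Admissible AT] [Admissible AV] (S : R.GStructure AU AT AV) :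
    RecollementDiagram (EquivariantObject AU) (EquivariantObject AT) (EquivariantObject AV) where
  i := S.i.equivariant
  q := S.q.equivariant
  p := S.p.equivariant
  e := S.e.equivariant
  l := S.l.equivariant
  r := S.r.equivariant
  adj_qi := equivariantAdjunction S.q S.i R.adj_qi S.unit_qi S.counit_qi
  adj_ip := equivariantAdjunction S.i S.p R.adj_ip S.unit_ip S.counit_ip
  adj_le := equivariantAdjunction S.l S.e R.adj_le S.unit_le S.counit_le
  adj_er := equivariantAdjunction S.e S.r R.adj_er S.unit_er S.counit_er
  commShift_i := inferInstance
  commShift_q := inferInstance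
  commShift_p := inferInstance
  commShift_e := inferInstance
  commShift_l := inferInstance
  commShift_r := inferInstance

/-- `(U^G, T^G, V^G)` is a recollement of triangulated categories, for given canonical
triangulated structures on the equivariant categories. -/
def RecollementDiagram.IsEquivariantRecollement (R : RecollementDiagram U T V)
    {AU : RightAction G U} {AT : RightAction G T} {AV : RightAction G V}
    [Admissible AU] [Admissible AT] [Admissible AV] (S : R.GStructure AU AT AV)
    (PU : CanonicalTriangulation AU) (PT : CanonicalTriangulation AT)
    (PV : CanonicalTriangulation AV) : Prop :=
  letI := PU.pretriangulated
  letI := PT.pretriangulated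
  letI := PV.pretriangulated
  (R.equivariant S).IsRecollement

end Recollement

end

end EquivariantRecollement

open EquivariantRecollement

/-!
A `G`-functor structure on a functor with a right (or left) adjoint is carried over to the adjoint
by taking mates: the mates are invertible because the functors `ρ_g` are equivalences, and mates are
compatible with the composition isomorphisms `θ_{g,h}` and with the shifts.

If `e` is a `G`-functor, then `U = Ker e` is invariant. Conversely, if `U` is invariant, then so is
its right orthogonal, which is the essential image of `r`. Both `U` and `V` are thus invariant
reflective subcategories of `T`, via `i` and `r`, and the action restricts to them: `X^g` is lifted
along the inclusion by means of the reflector, and the isomorphisms `θ_{g,h}` are lifted by full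
faithfulness. The structure on `e` is then obtained from the one on its right adjoint `r`.

The functors `q^G` and `e^G` have fully faithful right adjoints and are therefore localizations of
`T^G`. Since `For : V^G ⥤ V` reflects isomorphisms, `e^G` inverts the same morphisms as the
triangulated functor `For ⋙ e`, namely those whose cone is killed by it. So `V^G` is a Verdier
quotient of `T^G`, and inherits a triangulated structure; likewise `U^G`.
-/

namespace EquivariantRecollement

noncomputable section

section Mates

open scoped TwoSquare

variable {C : Type*} [Category* C] {D : Type*} [Category* D]
  {C' : Type*} [Category* C'] {D' : Type*} [Category* D']
  {F : C ⥤ D} {H : D ⥤ C} {F' : C' ⥤ D'} {H' : D' ⥤ C'} (adj : F ⊣ H) (adj' : F' ⊣ H')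
  {P : C ⥤ C'} {Q : D ⥤ D'}

lemma mateEquiv_whiskerTop {P' : C ⥤ C'} (α : TwoSquare P' F F' Q) (φ : P ⟶ P') :
    mateEquiv adj adj' (α.whiskerTop φ) = (mateEquiv adj adj' α).whiskerRight φ := by
  ext Y
  simp

lemma mateEquiv_whiskerBottom {Q' : D ⥤ D'} (α : TwoSquare P F F' Q) (ψ : Q ⟶ Q') :
    mateEquiv adj adj' (α.whiskerBottom ψ) = (mateEquiv adj adj' α).whiskerLeft ψ := by
  ext Y
  simp [← Functor.map_comp]

lemma isIso_mateEquiv_iff_of_isEquivalence [F.IsEquivalence] [F'.IsEquivalence]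
    (α : TwoSquare P F F' Q) :
    IsIso (mateEquiv adj adj' α).natTrans ↔ IsIso α.natTrans := by
  have := adj.isEquivalence_right_of_isEquivalence_left
  have := adj'.isEquivalence_right_of_isEquivalence_left
  refine ⟨fun _ => ?_, fun _ => ?_⟩
  · rw [← (mateEquiv adj adj').symm_apply_apply α, mateEquiv_symm_apply]
    infer_instance
  · rw [mateEquiv_apply]
    infer_instance

lemma isIso_mateEquiv_iff [P.IsEquivalence] [Q.IsEquivalence] (α : TwoSquare P F F' Q) :
    IsIso (mateEquiv adj adj' α).natTrans ↔ IsIso α.natTrans := by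
  have adjP : P ⊣ P.inv := P.asEquivalence.toAdjunction
  have adjQ : Q ⊣ Q.inv := Q.asEquivalence.toAdjunction
  rw [← isIso_mateEquiv_iff_of_isEquivalence adjQ adjP (mateEquiv adj adj' α),
    iterated_mateEquiv_conjugateEquiv]
  exact ⟨fun _ => conjugateEquiv_of_iso (adj.comp adjQ) (adjP.comp adj') _,
    fun _ => conjugateEquiv_iso (adj.comp adjQ) (adjP.comp adj') _⟩

section CommShift

variable (S : Type*) [AddMonoid S] [HasShift C S] [HasShift D S] [HasShift C' S] [HasShift D' S]
  [F.CommShift S] [H.CommShift S] [F'.CommShift S] [H'.CommShift S] [P.CommShift S]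
  [Q.CommShift S] [adj.CommShift S] [adj'.CommShift S]

instance (α : TwoSquare P F F' Q) [NatTrans.CommShift α.natTrans S] :
    NatTrans.CommShift (mateEquiv adj adj' α).natTrans S := by
  rw [mateEquiv_apply]
  infer_instance

instance (β : TwoSquare H Q P H') [NatTrans.CommShift β.natTrans S] :
    NatTrans.CommShift ((mateEquiv adj adj').symm β).natTrans S := by
  rw [mateEquiv_symm_apply]
  infer_instance

end CommShift

end Mates

section DoctrinalAdjunction

open scoped TwoSquare

variable {G : Type w} [Group G] {C : Type*} [Category* C] {D : Type*} [Category* D]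
  {A : RightAction G C} {B : RightAction G D} {F : C ⥤ D} {H : D ⥤ C}

attribute [instance] RightAction.isEquivalence

lemma assoc_iff_hComp (σ : ∀ g, A.ρ g ⋙ F ≅ F ⋙ B.ρ g) (g h : G) :
    (∀ X, F.map ((A.θ g h).hom.app X) ≫ (σ (h * g)).hom.app X =
      (σ g).hom.app ((A.ρ h).obj X) ≫ (B.ρ g).map ((σ h).hom.app X) ≫
        (B.θ g h).hom.app (F.obj X)) ↔
    (TwoSquare.mk _ _ _ _ (σ (h * g)).hom).whiskerTop (A.θ g h).hom =
      (TwoSquare.mk _ _ _ _ (σ h).hom ≫ₕ TwoSquare.mk _ _ _ _ (σ g).hom).whiskerBottom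
        (B.θ g h).hom := by
  refine ⟨fun h' => ?_, fun h' X => ?_⟩
  · ext X
    simpa using h' X
  · simpa using congr_app (congrArg TwoSquare.natTrans h') X

lemma assoc_iff_vComp (τ : ∀ g, B.ρ g ⋙ H ≅ H ⋙ A.ρ g) (g h : G) :
    (∀ Y, H.map ((B.θ g h).hom.app Y) ≫ (τ (h * g)).hom.app Y =
      (τ g).hom.app ((B.ρ h).obj Y) ≫ (A.ρ g).map ((τ h).hom.app Y) ≫
        (A.θ g h).hom.app (H.obj Y)) ↔
    (TwoSquare.mk _ _ _ _ (τ (h * g)).inv).whiskerRight (A.θ g h).hom =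
      (TwoSquare.mk _ _ _ _ (τ h).inv ≫ᵥ TwoSquare.mk _ _ _ _ (τ g).inv).whiskerLeft
        (B.θ g h).hom := by
  have cancel_isos (Y : D) := calc
    H.map ((B.θ g h).hom.app Y) ≫ (τ (h * g)).hom.app Y =
          (τ g).hom.app ((B.ρ h).obj Y) ≫ (A.ρ g).map ((τ h).hom.app Y) ≫
            (A.θ g h).hom.app (H.obj Y)
      ↔ ((A.ρ g).mapIso ((τ h).app Y)).inv ≫ ((τ g).app ((B.ρ h).obj Y)).inv ≫
          H.map ((B.θ g h).hom.app Y) ≫ ((τ (h * g)).app Y).hom =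
            (A.θ g h).hom.app (H.obj Y) := by rw [Iso.inv_comp_eq, Iso.inv_comp_eq]; rfl
    _ ↔ (A.θ g h).hom.app (H.obj Y) ≫ (τ (h * g)).inv.app Y =
        (A.ρ g).map ((τ h).inv.app Y) ≫ (τ g).inv.app ((B.ρ h).obj Y) ≫
          H.map ((B.θ g h).hom.app Y) := by
      rw [eq_comm, ← Category.assoc, ← Category.assoc, ← Iso.comp_inv_eq, Category.assoc]; rfl
  refine (forall_congr' cancel_isos).trans ⟨fun h' => ?_, fun h' Y => ?_⟩
  · ext Y
    simpa using h' Y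
  · simpa using congr_app (congrArg TwoSquare.natTrans h') Y

lemma assoc_iff_of_mates (adj : F ⊣ H) {σ : ∀ g, A.ρ g ⋙ F ≅ F ⋙ B.ρ g}
    {τ : ∀ g, B.ρ g ⋙ H ≅ H ⋙ A.ρ g}
    (hστ : ∀ g, mateEquiv adj adj (.mk _ _ _ _ (σ g).hom) = .mk _ _ _ _ (τ g).inv) (g h : G) :
    (∀ X, F.map ((A.θ g h).hom.app X) ≫ (σ (h * g)).hom.app X =
      (σ g).hom.app ((A.ρ h).obj X) ≫ (B.ρ g).map ((σ h).hom.app X) ≫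
        (B.θ g h).hom.app (F.obj X)) ↔
    (∀ Y, H.map ((B.θ g h).hom.app Y) ≫ (τ (h * g)).hom.app Y =
      (τ g).hom.app ((B.ρ h).obj Y) ≫ (A.ρ g).map ((τ h).hom.app Y) ≫
        (A.θ g h).hom.app (H.obj Y)) := by
  rw [assoc_iff_hComp, assoc_iff_vComp, ← (mateEquiv adj adj).apply_eq_iff_eq,
    mateEquiv_whiskerTop, mateEquiv_whiskerBottom, mateEquiv_vcomp adj adj adj, hστ, hστ, hστ]

instance (s : GFunctor A B F) (adj : F ⊣ H) (g : G) :
    IsIso (mateEquiv adj adj (.mk _ _ _ _ (s.σ g).hom)).natTrans :=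
  (isIso_mateEquiv_iff adj adj _).2 (inferInstanceAs (IsIso (s.σ g).hom))

instance (t : GFunctor B A H) (adj : F ⊣ H) (g : G) :
    IsIso ((mateEquiv adj adj).symm (.mk _ _ _ _ (t.σ g).inv)).natTrans := by
  rw [← isIso_mateEquiv_iff adj adj, Equiv.apply_symm_apply]
  exact inferInstanceAs (IsIso (t.σ g).inv)

/-- The `G`-functor structures `s` on `F` and `t` on its right adjoint `H` correspond to each other
under doctrinal adjunction: the mate of `s.σ g` is the inverse of `t.σ g`. -/
def GFunctor.AreMates (s : GFunctor A B F) (t : GFunctor B A H) (adj : F ⊣ H) : Prop :=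
  ∀ g, mateEquiv adj adj (.mk _ _ _ _ (s.σ g).hom) = .mk _ _ _ _ (t.σ g).inv

lemma GFunctor.AreMates.isGNatural_unit {s : GFunctor A B F} {t : GFunctor B A H} {adj : F ⊣ H}
    (h : s.AreMates t adj) : IsGNatural (GFunctor.id A) (s.comp t) adj.unit := by
  intro g X
  have unit_mate := unit_mateEquiv adj adj (.mk _ _ _ _ (s.σ g).hom) X
  rw [h g] at unit_mate
  simpa using ((Iso.comp_inv_eq ((t.σ g).app (F.obj X))).1 unit_mate).symm

lemma GFunctor.AreMates.isGNatural_counit {s : GFunctor A B F} {t : GFunctor B A H} {adj : F ⊣ H}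
    (h : s.AreMates t adj) : IsGNatural (t.comp s) (GFunctor.id B) adj.counit := by
  intro g Y
  have mate_counit := mateEquiv_counit adj adj (.mk _ _ _ _ (s.σ g).hom) Y
  rw [h g] at mate_counit
  simpa using (Iso.inv_comp_eq (F.mapIso ((t.σ g).app Y))).1 mate_counit

/-- The `G`-functor structure on the right adjoint of a `G`-functor given by doctrinal
adjunction. -/
def GFunctor.rightAdjoint (s : GFunctor A B F) (adj : F ⊣ H) : GFunctor B A H where
  σ g := (asIso (mateEquiv adj adj (.mk _ _ _ _ (s.σ g).hom)).natTrans).symm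
  assoc g h := (assoc_iff_of_mates (σ := s.σ) (τ := fun g =>
    (asIso (mateEquiv adj adj (.mk _ _ _ _ (s.σ g).hom)).natTrans).symm) adj
      (fun _ => rfl) g h).1 (s.assoc g h)

lemma GFunctor.areMates_rightAdjoint (s : GFunctor A B F) (adj : F ⊣ H) :
    s.AreMates (s.rightAdjoint adj) adj := fun _ => rfl

/-- The `G`-functor structure on the left adjoint of a `G`-functor given by doctrinal
adjunction. -/
def GFunctor.leftAdjoint (t : GFunctor B A H) (adj : F ⊣ H) : GFunctor A B F where
  σ g := asIso ((mateEquiv adj adj).symm (.mk _ _ _ _ (t.σ g).inv)).natTrans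
  assoc g h := (assoc_iff_of_mates (τ := t.σ) (σ := fun g =>
    asIso ((mateEquiv adj adj).symm (.mk _ _ _ _ (t.σ g).inv)).natTrans) adj
      (fun _ => Equiv.apply_symm_apply _ _) g h).2 (t.assoc g h)

lemma GFunctor.leftAdjoint_areMates (t : GFunctor B A H) (adj : F ⊣ H) :
    (t.leftAdjoint adj).AreMates t adj := fun _ => Equiv.apply_symm_apply _ _

end DoctrinalAdjunction

section EquivariantFunctor

open EquivariantObject

variable {G : Type w} [Group G] {C : Type*} [Category* C] {D : Type*} [Category* D]
  {A : RightAction G C} {B : RightAction G D} {F : C ⥤ D}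

instance : (forget A).ReflectsIsomorphisms where
  reflects f hf := by
    have : IsIso (Hom.hom f) := hf
    exact (EquivariantObject.isoMk (asIso (Hom.hom f)) f.comm).isIso_hom

instance (s : GFunctor A B F) [F.Faithful] : s.equivariant.Faithful where
  map_injective h := hom_ext (F.map_injective (congrArg Hom.hom h))

instance (s : GFunctor A B F) [F.Full] [F.Faithful] : s.equivariant.Full where
  map_surjective {X Y} f := by
    obtain ⟨f', hf⟩ : ∃ f' : X.obj ⟶ Y.obj, F.map f' = f.hom := F.map_surjective _
    refine ⟨{ hom := f', comm := fun g => F.map_injective ?_ }, hom_ext hf⟩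
    have comm_f : (F.map (X.χ g).hom ≫ (s.σ g).hom.app X.obj) ≫ (B.ρ g).map (F.map f') =
        F.map f' ≫ F.map (Y.χ g).hom ≫ (s.σ g).hom.app Y.obj := hf ▸ f.comm g
    have naturality_σ : F.map ((A.ρ g).map f') ≫ (s.σ g).hom.app Y.obj =
        (s.σ g).hom.app X.obj ≫ (B.ρ g).map (F.map f') := (s.σ g).hom.naturality f'
    rw [← cancel_mono ((s.σ g).hom.app Y.obj), Functor.map_comp, Functor.map_comp,
      Category.assoc, Category.assoc, ← comm_f, Category.assoc]
    exact congrArg (F.map (X.χ g).hom ≫ ·) naturality_σ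

/-- The identity `F^G ⋙ For = For ⋙ F`. -/
def GFunctor.equivariantForgetIso (s : GFunctor A B F) :
    s.equivariant ⋙ forget B ≅ forget A ⋙ F :=
  NatIso.ofComponents (fun X => Iso.refl (F.obj X.obj)) (fun _ =>
    (Category.comp_id _).trans (Category.id_comp _).symm)

end EquivariantFunctor

section Restriction

variable {G : Type w} [Group G] {C : Type*} [Category* C] {D : Type*} [Category* D]

/-- The canonical isomorphism `ρ_1 ≅ 𝟭`, obtained by cancelling one factor `ρ_1` in
`θ_{1,1} : ρ_1 ∘ ρ_1 ≅ ρ_1`. -/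
def RightAction.oneIso (A : RightAction G C) : A.ρ 1 ≅ 𝟭 C :=
  ((Functor.FullyFaithful.ofFullyFaithful (A.ρ 1)).whiskeringRight C).preimageIso
    (A.θ 1 1 ≪≫ eqToIso (by rw [mul_one]) ≪≫ (Functor.leftUnitor _).symm)

/-- The canonical isomorphism `ρ_{g⁻¹} ∘ ρ_g ≅ 𝟭`. -/
def RightAction.compInvIso (A : RightAction G C) (g : G) : A.ρ g ⋙ A.ρ g⁻¹ ≅ 𝟭 C :=
  A.θ g⁻¹ g ≪≫ eqToIso (by rw [mul_inv_cancel]) ≪≫ A.oneIso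

lemma isEquivalence_of_multiplicative {ρ : G → C ⥤ C} (θ : ∀ g h, ρ h ⋙ ρ g ≅ ρ (h * g))
    (one : ρ 1 ≅ 𝟭 C) (g : G) : (ρ g).IsEquivalence :=
  (CategoryTheory.Equivalence.mk (ρ g) (ρ g⁻¹)
    (θ g⁻¹ g ≪≫ eqToIso (by rw [mul_inv_cancel]) ≪≫ one).symm
    (θ g g⁻¹ ≪≫ eqToIso (by rw [inv_mul_cancel]) ≪≫ one)).isEquivalence_functor

namespace RightAction

variable (A : RightAction G C) {L : D ⥤ C} {ρ : G → D ⥤ D} (σ : ∀ g, ρ g ⋙ L ≅ L ⋙ A.ρ g)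

/-- The isomorphism `L ∘ ρ_g ∘ ρ_h ≅ L ∘ ρ_{hg}` which the composition isomorphism `θ_{g,h}` of
the action `A` induces through `σ`. -/
def restrictCompIso (g h : G) : (ρ h ⋙ ρ g) ⋙ L ≅ ρ (h * g) ⋙ L :=
  Functor.associator _ _ _ ≪≫ Functor.isoWhiskerLeft (ρ h) (σ g) ≪≫
    (Functor.associator _ _ _).symm ≪≫ Functor.isoWhiskerRight (σ h) (A.ρ g) ≪≫
    Functor.associator _ _ _ ≪≫ Functor.isoWhiskerLeft L (A.θ g h) ≪≫ (σ (h * g)).symm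

variable (hL : L.FullyFaithful)

/-- The composition isomorphisms of the restriction of an action along a fully faithful functor. -/
def restrictθ (g h : G) : ρ h ⋙ ρ g ≅ ρ (h * g) :=
  (hL.whiskeringRight D).preimageIso (A.restrictCompIso σ g h)

lemma whiskerRight_restrictθ_hom (g h : G) :
    Functor.whiskerRight (A.restrictθ σ hL g h).hom L = (A.restrictCompIso σ g h).hom :=
  (hL.whiskeringRight D).map_preimage _

lemma map_restrictθ_hom_app_comp (g h : G) (X : D) :
    L.map ((A.restrictθ σ hL g h).hom.app X) ≫ (σ (h * g)).hom.app X =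
      (σ g).hom.app ((ρ h).obj X) ≫ (A.ρ g).map ((σ h).hom.app X) ≫
        (A.θ g h).hom.app (L.obj X) := by
  have map_restrictθ := congr_app (A.whiskerRight_restrictθ_hom σ hL g h) X
  rw [Functor.whiskerRight_app] at map_restrictθ
  simp [map_restrictθ, restrictCompIso]

variable {A} in
lemma map_eqToHom_comp_hom_app {a b : G} (h : a = b) (X : D) :
    L.map (eqToHom (by rw [h] : (ρ a).obj X = (ρ b).obj X)) ≫ (σ b).hom.app X =
      (σ a).hom.app X ≫ eqToHom (by rw [h]) := by
  subst h
  simp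

lemma restrictθ_cocycle (g h k : G) (X : D) :
    (ρ g).map ((A.restrictθ σ hL h k).hom.app X) ≫ (A.restrictθ σ hL g (k * h)).hom.app X =
      (A.restrictθ σ hL g h).hom.app ((ρ k).obj X) ≫ (A.restrictθ σ hL (h * g) k).hom.app X ≫
        eqToHom (by rw [mul_assoc]) := by
  apply hL.map_injective
  rw [← cancel_mono ((σ (k * h * g)).hom.app X)]
  have naturality_σ := (σ g).hom.naturality ((A.restrictθ σ hL h k).hom.app X)
  have naturality_θ := (A.θ g h).hom.naturality ((σ k).hom.app X)
  have map_outer := A.map_restrictθ_hom_app_comp σ hL g (k * h) X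
  have map_inner := congrArg (A.ρ g).map (A.map_restrictθ_hom_app_comp σ hL h k X)
  have map_outer' := A.map_restrictθ_hom_app_comp σ hL (h * g) k X
  have map_inner' := A.map_restrictθ_hom_app_comp σ hL g h ((ρ k).obj X)
  have map_eqToHom := map_eqToHom_comp_hom_app σ (mul_assoc k h g).symm X
  have cocycle := A.cocycle g h k (L.obj X)
  simp only [Functor.comp_obj, Functor.comp_map, Functor.map_comp] at *
  simp only [Category.assoc]
  rw [map_outer, reassoc_of% naturality_σ, reassoc_of% map_inner, cocycle]
  erw [map_eqToHom]
  rw [reassoc_of% map_outer', reassoc_of% map_inner', reassoc_of% naturality_θ]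

/-- The restriction of an action on `C` along a fully faithful functor `L : D ⥤ C`, for given
endofunctors `ρ g` of `D` lifting the endofunctors `A.ρ g` of `C` along `L`. -/
def restrict : RightAction G D where
  ρ := ρ
  isEquivalence := isEquivalence_of_multiplicative (A.restrictθ σ hL)
    ((hL.whiskeringRight D).preimageIso (σ 1 ≪≫ Functor.isoWhiskerLeft L A.oneIso ≪≫
      Functor.rightUnitor _ ≪≫ (Functor.leftUnitor _).symm))
  θ := A.restrictθ σ hL
  cocycle := A.restrictθ_cocycle σ hL

/-- The functor along which an action is restricted, as a `G`-functor. -/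
def restrictGFunctor : GFunctor (A.restrict σ hL) A L where
  σ := σ
  assoc := A.map_restrictθ_hom_app_comp σ hL

end RightAction

end Restriction

section Triangulated

lemma commShift_of_whiskerRight {S : Type*} [AddMonoid S] {C : Type*} [Category* C] [HasShift C S]
    {D : Type*} [Category* D] [HasShift D S] {E : Type*} [Category* E] [HasShift E S] (L : D ⥤ E)
    [L.CommShift S] [L.Faithful] {F H : C ⥤ D} [F.CommShift S] [H.CommShift S] (τ : F ⟶ H)
    [NatTrans.CommShift (Functor.whiskerRight τ L) S] : NatTrans.CommShift τ S := ⟨fun n => by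
  ext X
  apply L.map_injective
  have shift_whisker := NatTrans.shift_app_comm (Functor.whiskerRight τ L) n X
  have naturality_shift := (L.commShiftIso n).hom.naturality (τ.app X)
  simp only [Functor.commShiftIso_comp_hom_app, Functor.whiskerRight_app, Category.assoc,
    Functor.comp_obj, Functor.comp_map] at shift_whisker naturality_shift
  rw [← naturality_shift, ← Functor.map_comp_assoc, ← Functor.map_comp_assoc,
    cancel_mono] at shift_whisker
  exact shift_whisker⟩

variable {G : Type w} [Group G]
  {C : Type*} [Category* C] [HasZeroObject C] [HasShift C ℤ] [Preadditive C]
  [∀ n : ℤ, (shiftFunctor C n).Additive] [Pretriangulated C]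
  {D : Type*} [Category* D] [HasZeroObject D] [HasShift D ℤ] [Preadditive D]
  [∀ n : ℤ, (shiftFunctor D n).Additive] [Pretriangulated D]

section

variable (A : RightAction G C) [Admissible A] {ρ : G → D ⥤ D} [∀ g, (ρ g).CommShift ℤ]
  {L : D ⥤ C} [L.CommShift ℤ]
  (σ : ∀ g, ρ g ⋙ L ≅ L ⋙ A.ρ g) [∀ g, NatTrans.CommShift (σ g).hom ℤ] (hL : L.FullyFaithful)

instance (g h : G) : NatTrans.CommShift (A.restrictθ σ hL g h).hom ℤ := by
  have := hL.faithful
  have : NatTrans.CommShift (Functor.whiskerRight (A.restrictθ σ hL g h).hom L) ℤ := by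
    rw [A.whiskerRight_restrictθ_hom]
    dsimp only [RightAction.restrictCompIso, Iso.trans_hom, Iso.symm_hom,
      Functor.isoWhiskerRight_hom, Functor.isoWhiskerLeft_hom]
    infer_instance
  exact commShift_of_whiskerRight L _

variable [∀ g, (ρ g).IsTriangulated]

instance : Admissible (A.restrict σ hL) where
  commShift g := inferInstanceAs ((ρ g).CommShift ℤ)
  isTriangulated g := inferInstanceAs ((ρ g).IsTriangulated)
  commShift_θ g h := inferInstanceAs (NatTrans.CommShift (A.restrictθ σ hL g h).hom ℤ)

instance : IsTriangulatedGFunctor (A.restrictGFunctor σ hL) where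
  commShift_σ g := inferInstanceAs (NatTrans.CommShift (σ g).hom ℤ)

end

lemma IsGInvariant.exists_admissible_of_fullyFaithful {A : RightAction G C} [Admissible A]
    {K : C ⥤ D} {L : D ⥤ C} [K.CommShift ℤ] [K.IsTriangulated] [L.CommShift ℤ] [L.IsTriangulated]
    [L.Full] [L.Faithful] (adj : K ⊣ L) [adj.CommShift ℤ] (hA : IsGInvariant A L.essImage) :
    ∃ (B : RightAction G D) (_ : Admissible B) (s : GFunctor B A L),
      IsTriangulatedGFunctor s := by
  have (g : G) : IsIso (Functor.whiskerLeft (L ⋙ A.ρ g) adj.unit) := by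
    have (Y : D) : IsIso ((Functor.whiskerLeft (L ⋙ A.ρ g) adj.unit).app Y) :=
      adj.isIso_unit_app_iff_mem_essImage.2 (hA g _ (L.obj_mem_essImage Y))
    exact NatIso.isIso_of_isIso_app _
  let reflect (g : G) : ((L ⋙ A.ρ g) ⋙ K) ⋙ L ≅ L ⋙ A.ρ g :=
    Functor.associator _ _ _ ≪≫ (asIso (Functor.whiskerLeft (L ⋙ A.ρ g) adj.unit)).symm ≪≫
      Functor.rightUnitor _
  have (g : G) : NatTrans.CommShift (reflect g).hom ℤ := by
    have : NatTrans.CommShift (asIso (Functor.whiskerLeft (L ⋙ A.ρ g) adj.unit)).hom ℤ :=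
      inferInstanceAs (NatTrans.CommShift (Functor.whiskerLeft (L ⋙ A.ρ g) adj.unit) ℤ)
    have := NatTrans.CommShift.of_iso_symm (asIso (Functor.whiskerLeft (L ⋙ A.ρ g) adj.unit)) ℤ
    dsimp only [reflect, Iso.trans_hom]
    infer_instance
  exact ⟨A.restrict reflect (.ofFullyFaithful L), inferInstance, A.restrictGFunctor reflect _,
    inferInstance⟩

variable {A : RightAction G C} {B : RightAction G D} [Admissible A] [Admissible B]
  {F : C ⥤ D} [F.CommShift ℤ]

section

variable {H : D ⥤ C} [H.CommShift ℤ] (adj : F ⊣ H) [adj.CommShift ℤ]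

instance (s : GFunctor A B F) [IsTriangulatedGFunctor s] :
    IsTriangulatedGFunctor (s.rightAdjoint adj) where
  commShift_σ g := by
    have : NatTrans.CommShift
        (asIso (mateEquiv adj adj (.mk _ _ _ _ (s.σ g).hom)).natTrans).hom ℤ :=
      inferInstanceAs
        (NatTrans.CommShift (mateEquiv adj adj (.mk _ _ _ _ (s.σ g).hom)).natTrans ℤ)
    exact NatTrans.CommShift.of_iso_symm _ ℤ

instance (t : GFunctor B A H) [IsTriangulatedGFunctor t] :
    IsTriangulatedGFunctor (t.leftAdjoint adj) where
  commShift_σ g := inferInstanceAs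
    (NatTrans.CommShift ((mateEquiv adj adj).symm (.mk _ _ _ _ (t.σ g).inv)).natTrans ℤ)

instance (s : GFunctor A B F) (t : GFunctor B A H) [IsTriangulatedGFunctor s]
    [IsTriangulatedGFunctor t] (hunit : IsGNatural (GFunctor.id A) (s.comp t) adj.unit)
    (hcounit : IsGNatural (t.comp s) (GFunctor.id B) adj.counit) :
    (equivariantAdjunction s t adj hunit hcounit).CommShift ℤ := by
  refine .mk' _ _ ⟨fun n => ?_⟩
  ext X
  have shift_unit := NatTrans.shift_app_comm adj.unit n X.obj
  rw [Functor.commShiftIso_comp_hom_app] at shift_unit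
  simp only [NatTrans.comp_app, Functor.commShiftIso_comp_hom_app]
  exact shift_unit

end

open EquivariantObject

lemma isZero_iff_isZero_obj (X : EquivariantObject A) : IsZero X ↔ IsZero X.obj := by
  rw [IsZero.iff_id_eq_zero, IsZero.iff_id_eq_zero, EquivariantObject.hom_ext_iff]
  rfl

instance (s : GFunctor A B F) [F.Additive] : s.equivariant.Additive where
  map_add {_ _ f g} := hom_ext (F.map_add (f := f.hom) (g := g.hom))

instance (s : GFunctor A B F) [IsTriangulatedGFunctor s] :
    NatTrans.CommShift s.equivariantForgetIso.hom ℤ := ⟨fun n => by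
  ext X
  simp only [NatTrans.comp_app, Functor.commShiftIso_comp_hom_app, Functor.whiskerRight_app,
    Functor.whiskerLeft_app]
  change ((F.commShiftIso n).hom.app X.obj ≫ 𝟙 _) ≫ (𝟙 (F.obj X.obj))⟦n⟧' =
    𝟙 _ ≫ F.map (𝟙 _) ≫ (F.commShiftIso n).hom.app X.obj
  simp⟩

end Triangulated

section Kernel

open Pretriangulated MorphismProperty

variable {C : Type*} [Category* C] {D : Type*} [Category* D] {F : C ⥤ D}

lemma essImage_eq_isLocal_inverseImage_isomorphisms {H : D ⥤ C} [H.Full] [H.Faithful]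
    (adj : F ⊣ H) : H.essImage = ((isomorphisms D).inverseImage F).isLocal := by
  rw [← ObjectProperty.isLocal_eq_inverseImage_isomorphisms adj]
  have obj_isLocal (Y : D) : (ObjectProperty.isLocal (· ∈ Set.range H.obj)).isLocal (H.obj Y) :=
    ObjectProperty.le_isLocal_isLocal _ _ ⟨Y, rfl⟩
  ext X
  constructor
  · rintro ⟨Y, ⟨e⟩⟩
    exact ObjectProperty.prop_of_iso _ e (obj_isLocal Y)
  · intro hX
    have : IsIso (adj.unit.app X) := (ObjectProperty.isLocal_iff_isIso _ _ hX (obj_isLocal _)).1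
      (MorphismProperty.le_isLocal_isLocal _ _ (ObjectProperty.isLocal_adj_unit_app adj X))
    exact adj.mem_essImage_of_unit_isIso X

variable [HasZeroObject C] [HasShift C ℤ] [Preadditive C]
  [∀ n : ℤ, (shiftFunctor C n).Additive] [Pretriangulated C]
  [HasZeroObject D] [HasShift D ℤ] [Preadditive D]
  [∀ n : ℤ, (shiftFunctor D n).Additive] [Pretriangulated D] [F.CommShift ℤ] [F.IsTriangulated]

instance : ObjectProperty.IsTriangulated (C := D) IsZero where
  isStableUnderShiftBy n := ⟨fun _ hX => (shiftFunctor D n).map_isZero hX⟩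
  toIsTriangulatedClosed₂ := .mk' fun T hT h₁ h₃ => T.isZero₂_of_isZero₁₃ hT h₁ h₃

variable (F) in
lemma trW_kernel : F.kernel.trW = (isomorphisms D).inverseImage F := by
  ext X Y f
  obtain ⟨Z, g, h, hT⟩ := distinguished_cocone_triangle f
  exact (F.kernel.trW_iff_of_distinguished _ hT).trans
    (Triangle.isZero₃_iff_isIso₁ _ (F.map_distinguished _ hT))

lemma essImage_eq_rightOrthogonal_kernel {H : D ⥤ C} [H.Full] [H.Faithful]
    (adj : F ⊣ H) : H.essImage = F.kernel.rightOrthogonal := by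
  rw [essImage_eq_isLocal_inverseImage_isomorphisms adj, ← trW_kernel, ObjectProperty.isLocal_trW]

end Kernel

section CanonicalTriangulation

open Pretriangulated MorphismProperty EquivariantObject

variable {G : Type w} [Group G]
  {C : Type*} [Category* C] [HasZeroObject C] [HasShift C ℤ] [Preadditive C]
  [∀ n : ℤ, (shiftFunctor C n).Additive] [Pretriangulated C]
  {D : Type*} [Category* D] [HasZeroObject D] [HasShift D ℤ] [Preadditive D]
  [∀ n : ℤ, (shiftFunctor D n).Additive] [Pretriangulated D]
  {A : RightAction G C} {B : RightAction G D} [Admissible A]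
  {F : C ⥤ D} [F.CommShift ℤ] [F.IsTriangulated]

-- The triangulated structure on `D^G` is yet to be found, so the class of morphisms which `F^G`
-- inverts is described by the triangulated functor `For ⋙ F` with values in `D`.
lemma trW_kernel_forget_comp (PC : CanonicalTriangulation A) (s : GFunctor A B F) :
    letI := PC.pretriangulated
    (forget A ⋙ F).kernel.trW = (isomorphisms _).inverseImage s.equivariant := by
  let := PC.pretriangulated
  have := PC.forget_isTriangulated
  rw [trW_kernel]
  ext X Y f
  exact isIso_iff_of_reflects_iso (s.equivariant.map f) (forget B)

lemma CanonicalTriangulation.exists_of_adjunction [Admissible B]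
    (PC : CanonicalTriangulation A) (s : GFunctor A B F)
    [IsTriangulatedGFunctor s] {K : EquivariantObject B ⥤ EquivariantObject A} [K.Full] [K.Faithful]
    (adj : s.equivariant ⊣ K) :
    letI := PC.pretriangulated
    ∃ PD : CanonicalTriangulation B,
      letI := PD.pretriangulated
      s.equivariant.IsTriangulated := by
  let := PC.pretriangulated
  have := PC.isTriangulated
  have := PC.forget_isTriangulated
  let W := (forget A ⋙ F).kernel.trW
  have : s.equivariant.IsLocalization W := by
    dsimp only [W]
    rw [trW_kernel_forget_comp PC s]
    exact adj.isLocalization_leftAdjoint'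
  let : Pretriangulated (EquivariantObject B) :=
    Triangulated.Localization.pretriangulated s.equivariant W
  have := Localization.essSurj_mapArrow s.equivariant W
  exact ⟨⟨inferInstance, Triangulated.Localization.isTriangulated s.equivariant W,
    Functor.isTriangulated_of_precomp_iso s.equivariantForgetIso⟩,
    Triangulated.Localization.isTriangulated_functor s.equivariant W⟩

end CanonicalTriangulation

section Recollement

open EquivariantObject

lemma IsGInvariant.rightOrthogonal {G : Type w} [Group G] {C : Type*} [Category* C]
    [HasZeroMorphisms C] {A : RightAction G C} {P : ObjectProperty C} (hP : IsGInvariant A P) :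
    IsGInvariant A P.rightOrthogonal := by
  intro g X hX Y f hY
  have comp_eq_zero : (A.ρ g⁻¹).map f ≫ (A.compInvIso g).hom.app X = 0 := hX _ (hP g⁻¹ Y hY)
  apply (A.ρ g⁻¹).map_injective
  rw [Functor.map_zero]
  exact zero_of_comp_mono _ comp_eq_zero

lemma GFunctor.isGInvariant_kernel {G : Type w} [Group G] {C : Type*} [Category* C]
    {D : Type*} [Category* D] [HasZeroMorphisms D] {A : RightAction G C} {B : RightAction G D}
    {F : C ⥤ D} (s : GFunctor A B F) : IsGInvariant A F.kernel := fun g X hX =>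
  ((B.ρ g).map_isZero hX).of_iso ((s.σ g).app X)

variable {U : Type*} [Category* U] [HasZeroObject U] [HasShift U ℤ] [Preadditive U]
  [∀ n : ℤ, (shiftFunctor U n).Additive] [Pretriangulated U]
  {T : Type*} [Category* T] [HasZeroObject T] [HasShift T ℤ] [Preadditive T]
  [∀ n : ℤ, (shiftFunctor T n).Additive] [Pretriangulated T]
  {V : Type*} [Category* V] [HasZeroObject V] [HasShift V ℤ] [Preadditive V]
  [∀ n : ℤ, (shiftFunctor V n).Additive] [Pretriangulated V]
  {R : RecollementDiagram U T V}

namespace RecollementDiagram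

lemma IsRecollement.of_isTriangulated [R.q.IsTriangulated] [R.e.IsTriangulated]
    [R.adj_qi.CommShift ℤ] [R.adj_ip.CommShift ℤ] [R.adj_le.CommShift ℤ] [R.adj_er.CommShift ℤ]
    [R.i.Full] [R.i.Faithful] [R.l.Full] [R.l.Faithful] [R.r.Full] [R.r.Faithful]
    (essImage_i : R.i.essImage = R.e.kernel) : R.IsRecollement :=
  have isTriangulated_i := R.adj_qi.isTriangulated_rightAdjoint
  { isTriangulated_i
    isTriangulated_q := inferInstance
    isTriangulated_p := R.adj_ip.isTriangulated_rightAdjoint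
    isTriangulated_e := inferInstance
    isTriangulated_l := R.adj_le.isTriangulated_leftAdjoint
    isTriangulated_r := R.adj_er.isTriangulated_rightAdjoint
    commShift_qi := inferInstance
    commShift_ip := inferInstance
    commShift_le := inferInstance
    commShift_er := inferInstance
    full_i := inferInstance
    faithful_i := inferInstance
    full_l := inferInstance
    faithful_l := inferInstance
    full_r := inferInstance
    faithful_r := inferInstance
    essImage_i_iff X := iff_of_eq (congrFun essImage_i X) }

namespace IsRecollement

variable (hR : R.IsRecollement)
include hR

lemma essImage_i : R.i.essImage = R.e.kernel := by
  ext X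
  exact hR.essImage_i_iff X

variable {G : Type w} [Group G] {AT : RightAction G T} [Admissible AT]

lemma exists_admissible_i (hU : IsGInvariant AT R.i.essImage) :
    ∃ (AU : RightAction G U) (_ : Admissible AU) (s : GFunctor AU AT R.i),
      IsTriangulatedGFunctor s := by
  have := hR.full_i
  have := hR.faithful_i
  have := hR.isTriangulated_i
  have := hR.isTriangulated_q
  have := hR.commShift_qi
  exact hU.exists_admissible_of_fullyFaithful R.adj_qi

-- The functor `r` identifies `V` with the right orthogonal of `U`.
lemma exists_admissible_e (hU : IsGInvariant AT R.i.essImage) :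
    ∃ (AV : RightAction G V) (_ : Admissible AV) (s : GFunctor AT AV R.e),
      IsTriangulatedGFunctor s := by
  have := hR.full_r
  have := hR.faithful_r
  have := hR.isTriangulated_e
  have := hR.isTriangulated_r
  have := hR.commShift_er
  rw [hR.essImage_i] at hU
  have hV : IsGInvariant AT R.r.essImage := by
    rw [essImage_eq_rightOrthogonal_kernel R.adj_er]
    exact hU.rightOrthogonal
  obtain ⟨AV, _, t, _⟩ := hV.exists_admissible_of_fullyFaithful R.adj_er
  exact ⟨AV, inferInstance, t.leftAdjoint R.adj_er, inferInstance⟩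

variable {AU : RightAction G U} {AV : RightAction G V} [Admissible AU] [Admissible AV]

/-- The `G`-structure on a recollement in which `q`, `p`, `l` and `r` carry the structures of
adjoints of the triangulated `G`-functors `i` and `e`. -/
def gStructure (si : GFunctor AU AT R.i) (se : GFunctor AT AV R.e) [IsTriangulatedGFunctor si]
    [IsTriangulatedGFunctor se] : R.GStructure AU AT AV where
  i := si
  q := si.leftAdjoint R.adj_qi
  p := si.rightAdjoint R.adj_ip
  e := se
  l := se.leftAdjoint R.adj_le
  r := se.rightAdjoint R.adj_er
  isTriangulated_i := inferInstance
  isTriangulated_q := have := hR.commShift_qi; inferInstance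
  isTriangulated_p := have := hR.commShift_ip; inferInstance
  isTriangulated_e := inferInstance
  isTriangulated_l := have := hR.commShift_le; inferInstance
  isTriangulated_r := have := hR.commShift_er; inferInstance
  unit_qi := (si.leftAdjoint_areMates R.adj_qi).isGNatural_unit
  counit_qi := (si.leftAdjoint_areMates R.adj_qi).isGNatural_counit
  unit_ip := (si.areMates_rightAdjoint R.adj_ip).isGNatural_unit
  counit_ip := (si.areMates_rightAdjoint R.adj_ip).isGNatural_counit
  unit_le := (se.leftAdjoint_areMates R.adj_le).isGNatural_unit
  counit_le := (se.leftAdjoint_areMates R.adj_le).isGNatural_counit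
  unit_er := (se.areMates_rightAdjoint R.adj_er).isGNatural_unit
  counit_er := (se.areMates_rightAdjoint R.adj_er).isGNatural_counit

lemma essImage_equivariant_i (S : R.GStructure AU AT AV) :
    S.i.equivariant.essImage = S.e.equivariant.kernel := by
  have := hR.full_i
  have := hR.faithful_i
  let adj := equivariantAdjunction S.q S.i R.adj_qi S.unit_qi S.counit_qi
  ext X
  calc S.i.equivariant.essImage X
      ↔ IsIso (adj.unit.app X) := adj.isIso_unit_app_iff_mem_essImage.symm
    _ ↔ IsIso (R.adj_qi.unit.app X.obj) :=
      (isIso_iff_of_reflects_iso (adj.unit.app X) (forget AT)).symm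
    _ ↔ R.i.essImage X.obj := R.adj_qi.isIso_unit_app_iff_mem_essImage
    _ ↔ IsZero (R.e.obj X.obj) := hR.essImage_i_iff X.obj
    _ ↔ IsZero (S.e.equivariant.obj X) := (isZero_iff_isZero_obj (S.e.equivariant.obj X)).symm

lemma exists_isEquivariantRecollement (S : R.GStructure AU AT AV)
    (PT : CanonicalTriangulation AT) :
    ∃ (PU : CanonicalTriangulation AU) (PV : CanonicalTriangulation AV),
      R.IsEquivariantRecollement S PU PT PV := by
  have := hR.isTriangulated_q
  have := hR.isTriangulated_e
  have := hR.commShift_qi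
  have := hR.commShift_ip
  have := hR.commShift_le
  have := hR.commShift_er
  have := hR.full_i
  have := hR.faithful_i
  have := hR.full_l
  have := hR.faithful_l
  have := hR.full_r
  have := hR.faithful_r
  let := PT.pretriangulated
  obtain ⟨PU, _⟩ := PT.exists_of_adjunction S.q
    (equivariantAdjunction S.q S.i R.adj_qi S.unit_qi S.counit_qi)
  obtain ⟨PV, _⟩ := PT.exists_of_adjunction S.e
    (equivariantAdjunction S.e S.r R.adj_er S.unit_er S.counit_er)
  let := PU.pretriangulated
  let := PV.pretriangulated
  refine ⟨PU, PV, ?_⟩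
  unfold IsEquivariantRecollement equivariant
  exact .of_isTriangulated (hR.essImage_equivariant_i S)

end IsRecollement

end RecollementDiagram

end Recollement

end

end EquivariantRecollement

theorem mainTheorem3_general
    {U : Type u₁} [Category.{v₁} U] [HasZeroObject U] [HasShift U ℤ] [Preadditive U]
    [∀ n : ℤ, (shiftFunctor U n).Additive] [Pretriangulated U]
    {T : Type u₂} [Category.{v₂} T] [HasZeroObject T] [HasShift T ℤ] [Preadditive T]
    [∀ n : ℤ, (shiftFunctor T n).Additive] [Pretriangulated T]
    {V : Type u₃} [Category.{v₃} V] [HasZeroObject V] [HasShift V ℤ] [Preadditive V]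
    [∀ n : ℤ, (shiftFunctor V n).Additive] [Pretriangulated V]
    (R : RecollementDiagram U T V) (hR : R.IsRecollement)
    {G : Type w} [Group G] (AT : RightAction G T) [Admissible AT]
    (PT : CanonicalTriangulation AT) :
    List.TFAE [
      ∃ (AV : RightAction G V) (_ : Admissible AV) (s : GFunctor AT AV R.e),
        IsTriangulatedGFunctor s,
      ∃ (AV : RightAction G V) (_ : Admissible AV), Nonempty (GFunctor AT AV R.e),
      R.i.essImage.IsTriangulated ∧ IsGInvariant AT R.i.essImage] ∧
    (IsGInvariant AT R.i.essImage →
      ∃ (AU : RightAction G U) (_ : Admissible AU) (s : GFunctor AU AT R.i),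
        IsTriangulatedGFunctor s) ∧
    (∀ (AU : RightAction G U) [Admissible AU] (AV : RightAction G V) [Admissible AV]
      (si : GFunctor AU AT R.i) (se : GFunctor AT AV R.e),
      IsTriangulatedGFunctor si → IsTriangulatedGFunctor se →
      ∃ S : R.GStructure AU AT AV, S.i = si ∧ S.e = se ∧
        ∃ (PU : CanonicalTriangulation AU) (PV : CanonicalTriangulation AV),
          R.IsEquivariantRecollement S PU PT PV) := by
  have := hR.isTriangulated_i
  have := hR.full_i
  refine ⟨?_, hR.exists_admissible_i, fun AU _ AV _ si se _ _ =>
    ⟨hR.gStructure si se, rfl, rfl, hR.exists_isEquivariantRecollement _ PT⟩⟩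
  tfae_have 1 → 2 := fun ⟨AV, hAV, s, _⟩ => ⟨AV, hAV, ⟨s⟩⟩
  tfae_have 2 → 3 := fun ⟨_, _, ⟨s⟩⟩ => ⟨inferInstance, hR.essImage_i ▸ s.isGInvariant_kernel⟩
  tfae_have 3 → 1 := fun h => hR.exists_admissible_e h.2
  tfae_finish

theorem mainTheorem3
    {U : Type u₁} [Category.{v₁} U] [HasZeroObject U] [HasShift U ℤ] [Preadditive U]
    [∀ n : ℤ, (shiftFunctor U n).Additive] [Pretriangulated U] [IsTriangulated U]
    {T : Type u₂} [Category.{v₂} T] [HasZeroObject T] [HasShift T ℤ] [Preadditive T]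
    [∀ n : ℤ, (shiftFunctor T n).Additive] [Pretriangulated T] [IsTriangulated T]
    {V : Type u₃} [Category.{v₃} V] [HasZeroObject V] [HasShift V ℤ] [Preadditive V]
    [∀ n : ℤ, (shiftFunctor V n).Additive] [Pretriangulated V] [IsTriangulated V]
    (R : RecollementDiagram U T V) (hR : R.IsRecollement)
    {G : Type w} [Group G] [Finite G] (AT : RightAction G T) [Admissible AT]
    (hG : CardInvertible G T) (PT : CanonicalTriangulation AT) :
    -- `G` acts admissibly on `V` with `e` a (triangulated) `G`-functor iff `U` is `G`-invariant;
    -- for (i) ⟹ (ii), a `G`-functor structure on `e` not related to the shifts suffices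
    List.TFAE [
      ∃ (AV : RightAction G V) (_ : Admissible AV) (s : GFunctor AT AV R.e),
        IsTriangulatedGFunctor s,
      ∃ (AV : RightAction G V) (_ : Admissible AV), Nonempty (GFunctor AT AV R.e),
      R.i.essImage.IsTriangulated ∧ IsGInvariant AT R.i.essImage] ∧
    -- in this case `U` inherits an admissible action for which `i` is a triangulated `G`-functor
    (IsGInvariant AT R.i.essImage →
      ∃ (AU : RightAction G U) (_ : Admissible AU) (s : GFunctor AU AT R.i),
        IsTriangulatedGFunctor s) ∧
    -- and for all such actions on `U` and `V`, `(U^G, T^G, V^G)` is a recollement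
    (∀ (AU : RightAction G U) [Admissible AU] (AV : RightAction G V) [Admissible AV]
      (si : GFunctor AU AT R.i) (se : GFunctor AT AV R.e),
      IsTriangulatedGFunctor si → IsTriangulatedGFunctor se →
      ∃ S : R.GStructure AU AT AV, S.i = si ∧ S.e = se ∧
        ∃ (PU : CanonicalTriangulation AU) (PV : CanonicalTriangulation AV),
          R.IsEquivariantRecollement S PU PT PV) :=
  mainTheorem3_general R hR AT PT
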